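/- Let $Q(y|x_1,x_2)$ be a discrete memoryless multiple-access channel with finite alphabets $\mathcal X_1,\mathcal X_2,\mathcal Y$. All logarithms are to base $2$. Consider the following hybrid of hypothesis testing and data transmission. In $n$ uses of the channel, user 1 conveys a bit $\Theta\in\{0,1\}$ by repeating a symbol $x_1(\Theta)\in\mathcal X_1$ $n$ times. User 2 sends a message $W$, uniformly distributed on $M$ values and independent of $\Theta$, by a codeword $x_2^n(W)\in\mathcal X_2^n$. The receiver forms estimates $\hat\Theta$ and $\hat W$ from $Y^n$. For a distribution $P_{X_2}$ on $\mathcal X_2$ let $\bar Q(y|x_1)=\sum_{x_2}P_{X_2}(x_2)Q(y|x_1,x_2)$. Let $I(X_2;Y|x_1)$ be the mutual information of $X_2\sim P_{X_2}$ and the output $Y\sim Q(\cdot|x_1,X_2)$, and let $D(\cdot\|\cdot)\in[0,\infty]$ be the relative entropy. Then for all $x_1(0),x_1(1)\in\mathcal X_1$, every distribution $P_{X_2}$, every rate $$0\le R\le \min\{I(X_2;Y|x_1(0)),\,I(X_2;Y|x_1(1))\},$$ and all $\varepsilon,\delta>0$, there exists for all sufficiently large $n$ a code of this kind such that $$R-\delta\le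 \tfrac1n\log M\le R,\qquad \mathbb P(\hat W\ne W\mid\Theta=\theta)\le\varepsilon\ \ (\theta=0,1),\qquad \mathbb P(\hat\Theta=1\mid\Theta=0)\le\varepsilon,$$ and such that the type-II error satisfies $$\beta=\mathbb P(\hat\Theta=0\mid\Theta=1)\le 2^{-n\left(D(\bar Q(\cdot|x_1(0))\,\|\,\bar Q(\cdot|x_1(1)))-\delta\right)},$$ where $2^{-\infty}=0$, so that $\beta=0$ if the relative entropy is infinite. -/

import Mathlib

open Filter

noncomputable section

/-- Relative entropy `D(p ‖ q)` in bits of two probability mass functions on a finite alphabet,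
with value `⊤` when `p` is not absolutely continuous with respect to `q`. The conventions
`0 * log 0 = 0` and `0 * log (0 / 0) = 0` hold automatically. -/
def klBits {Y : Type*} [Fintype Y] (p q : Y → ℝ) : EReal :=
  open Classical in
  if ∀ y, q y = 0 → p y = 0 then ((∑ y, p y * Real.logb 2 (p y / q y) : ℝ) : EReal) else ⊤

/-- Mutual information in bits of a pair of random variables on finite alphabets with joint
probability mass function `J`:
`∑ J(x,y) log (J(x,y) / (J_X(x) J_Y(y)))`. -/
def mutualInfoBits {X Y : Type*} [Fintype X] [Fintype Y] (J : X → Y → ℝ) : ℝ :=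
  ∑ x, ∑ y, J x y * Real.logb 2 (J x y / ((∑ y', J x y') * (∑ x', J x' y)))

/-- The function `a ↦ 2^(-a)` on `(-∞, ∞]`, with `2^(-∞) = 0`. -/
def twoPowNeg (a : EReal) : ℝ :=
  open Classical in
  if a = ⊤ then 0 else (2 : ℝ) ^ (-a.toReal)

section Channel

variable {X₁ X₂ Y : Type*} [Fintype X₁] [Fintype X₂] [Fintype Y]

/-- The channel `Qbar(y|x₁) = ∑ P(x₂) Q(y|x₁,x₂)` seen by the first user when the second input
has distribution `P`. -/
def averagedChannel (Q : X₁ → X₂ → Y → ℝ) (P : X₂ → ℝ) (x₁ : X₁) (y : Y) : ℝ :=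
  ∑ x₂, P x₂ * Q x₁ x₂ y

/-- `I(X₂; Y | X₁ = x₁)` in bits, where `X₂` has distribution `P` and `Y` is the output of the
channel with inputs `x₁` and `X₂`. -/
def condInfo (Q : X₁ → X₂ → Y → ℝ) (P : X₂ → ℝ) (x₁ : X₁) : ℝ :=
  mutualInfoBits (fun x₂ y => P x₂ * Q x₁ x₂ y)

variable (X₁ X₂ Y) in
/-- A (deterministic, fixed-length) code of length `n` for the hybrid problem: the first encoder
conveys a bit `θ`, the second one a message from a set of `M` messages, and the receiver estimates
both from the output sequence. -/
structure HybridCode (n M : ℕ) where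
  /-- codewords of the first user, one for each value of the bit -/
  enc₁ : Fin 2 → Fin n → X₁
  /-- codewords of the second user, one for each message -/
  enc₂ : Fin M → Fin n → X₂
  /-- decoder of the bit -/
  decBit : (Fin n → Y) → Fin 2
  /-- decoder of the message -/
  decMsg : (Fin n → Y) → Fin M

namespace HybridCode

variable {n M : ℕ}

/-- Probability that the memoryless channel `Q` outputs the sequence `y` when the bit is `θ` and
the message is `m`. -/
def outputProb (c : HybridCode X₁ X₂ Y n M) (Q : X₁ → X₂ → Y → ℝ) (θ : Fin 2) (m : Fin M)
    (y : Fin n → Y) : ℝ :=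
  ∏ i, Q (c.enc₁ θ i) (c.enc₂ m i) (y i)

/-- The probability that the bit is decoded as `θ'` given that it is `θ`, the message being
uniformly distributed and independent of the bit. -/
def bitProb (c : HybridCode X₁ X₂ Y n M) (Q : X₁ → X₂ → Y → ℝ) (θ' θ : Fin 2) : ℝ :=
  (M : ℝ)⁻¹ * ∑ m : Fin M, ∑ y : Fin n → Y with c.decBit y = θ', c.outputProb Q θ m y

/-- The probability that a uniformly distributed message is decoded incorrectly, given that the
bit is `θ`. -/
def msgError (c : HybridCode X₁ X₂ Y n M) (Q : X₁ → X₂ → Y → ℝ) (θ : Fin 2) : ℝ :=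
  (M : ℝ)⁻¹ * ∑ m : Fin M, ∑ y : Fin n → Y with c.decMsg y ≠ m, c.outputProb Q θ m y

end HybridCode

end Channel

end

/-! Draw the codewords of user 2 independently from the product of `P`. Averaged over the codebook,
the output given θ is i.i.d. with law `averagedChannel Q P (x₁ θ)`, so a Stein test between these
two laws, ignoring the message, has the required exponent (`exists_test`). For the message, a
codeword passes if its information density is large under either value of θ. The true codeword
rarely fails (`exists_sum_memoryless_density_le_pow`). A wrong one is independent of the output and
passes with probability at most twice 2 to minus the threshold (`sum_iidProb_density_le`), so rates
below both informations are achievable. Four averages are thus small: message error and test error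
for each θ. Markov's inequality at level 4 gives one codebook good for all of them
(`exists_codebook`); a constant factor costs nothing in the exponent. -/

/-! ### Product distributions and the union bound. -/

/-- The probability of the sequence `x` when its letters are independent with distribution `p`. -/
def iidProb {ι A : Type*} [Fintype ι] (p : A → ℝ) (x : ι → A) : ℝ := ∏ i, p (x i)

theorem iidProb_nonneg {ι A : Type*} [Fintype ι] {p : A → ℝ} (hp : ∀ a, 0 ≤ p a) (x : ι → A) :
    0 ≤ iidProb p x :=
  Finset.prod_nonneg fun _ _ => hp _

theorem sum_iidProb_mul_prod {ι A : Type*} [Fintype ι] [Fintype A] (p : A → ℝ)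
    (g : ι → A → ℝ) : (open Classical in
      ∑ x : ι → A, iidProb p x * ∏ i, g i (x i)) = ∏ i, ∑ a, p a * g i a := by
  classical
  rw [Finset.prod_univ_sum, Fintype.piFinset_univ]
  exact Finset.sum_congr rfl fun x _ => Finset.prod_mul_distrib.symm

theorem iidProb_mem_stdSimplex {ι A : Type*} [Fintype ι] [DecidableEq ι] [Fintype A] {p : A → ℝ}
    (hp : p ∈ stdSimplex ℝ A) : iidProb p ∈ stdSimplex ℝ (ι → A) := by
  refine ⟨iidProb_nonneg hp.1, ?_⟩
  have := sum_iidProb_mul_prod (ι := ι) p fun _ _ => 1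
  simp only [Finset.prod_const_one, mul_one, hp.2] at this
  convert this

theorem sum_iidProb_mul {ι A : Type*} [Fintype ι] [DecidableEq ι] [Fintype A] {p : A → ℝ}
    (hp : ∑ a, p a = 1) (k : ι) (g : A → ℝ) :
    ∑ x : ι → A, iidProb p x * g (x k) = ∑ a, p a * g a := by
  classical
  have h := sum_iidProb_mul_prod (ι := ι) p fun i a => if i = k then g a else 1
  rw [Finset.prod_eq_single k (fun i _ hi => by simp [hi, hp]) (by simp)] at h
  simp only [Finset.prod_ite_eq', Finset.mem_univ, if_true] at h
  rw [← h]
  congr!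

theorem sum_iidProb_mul_mul {ι A : Type*} [Fintype ι] [DecidableEq ι] [Fintype A] {p : A → ℝ}
    (hp : ∑ a, p a = 1) {k l : ι} (hkl : k ≠ l) (g h : A → ℝ) :
    ∑ x : ι → A, iidProb p x * (g (x k) * h (x l)) = (∑ a, p a * g a) * ∑ a, p a * h a := by
  classical
  have H := sum_iidProb_mul_prod (ι := ι) p fun i a =>
    (if i = k then g a else 1) * (if i = l then h a else 1)
  rw [Finset.prod_eq_mul k l hkl (fun i _ hi => by simp [hi.1, hi.2, hp]) (by simp) (by simp)] at H
  simp only [Finset.prod_mul_distrib, Finset.prod_ite_eq', Finset.mem_univ, if_true, hkl, hkl.symm,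
    if_false, mul_one, one_mul] at H
  rw [← H]
  congr!

/-- Markov's inequality and the union bound. -/
theorem exists_forall_le_card_mul {Ω ι : Type*} [Fintype Ω] [Fintype ι] [Nonempty ι]
    {w : Ω → ℝ} (hw : w ∈ stdSimplex ℝ Ω) {f : ι → Ω → ℝ} (hf : ∀ i ω, 0 ≤ f i ω) {t : ι → ℝ}
    (ht : ∀ i, ∑ ω, w ω * f i ω ≤ t i) : ∃ ω, ∀ i, f i ω ≤ Fintype.card ι * t i := by
  classical
  by_contra! hcon
  have hc : (0 : ℝ) < Fintype.card ι := by exact_mod_cast Fintype.card_pos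
  -- Strictness matters: the bad events then have total weight below 1. It also holds when `t i =
  -- 0`, which is what yields an error of exactly zero under infinite divergence.
  have key : ∀ i, ∑ ω, (if Fintype.card ι * t i < f i ω then w ω else 0)
      < (Fintype.card ι : ℝ)⁻¹ := by
    intro i
    by_cases h : ∃ ω, Fintype.card ι * t i < f i ω ∧ 0 < w ω
    · obtain ⟨ω₀, h₀, hw₀⟩ := h
      have h1 : ∑ ω, (if Fintype.card ι * t i < f i ω then w ω else 0) * (Fintype.card ι * t i)
          < ∑ ω, w ω * f i ω := by
        refine Finset.sum_lt_sum (fun ω _ => ?_) ⟨ω₀, Finset.mem_univ _, ?_⟩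
        · split_ifs with h
          · exact mul_le_mul_of_nonneg_left h.le (hw.1 ω)
          · simpa using mul_nonneg (hw.1 ω) (hf i ω)
        · rw [if_pos h₀]
          exact mul_lt_mul_of_pos_left h₀ hw₀
      rw [← Finset.sum_mul] at h1
      have h0 : 0 ≤ t i :=
        (Finset.sum_nonneg fun ω _ => mul_nonneg (hw.1 ω) (hf i ω)).trans (ht i)
      have h2 := h1.trans_le (ht i)
      rw [← mul_assoc] at h2
      rw [← one_div, lt_div_iff₀ hc]
      by_contra! h3
      exact h2.not_ge (le_mul_of_one_le_left h0 h3)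
    · push Not at h
      refine lt_of_le_of_lt (Finset.sum_nonpos fun ω _ => ?_) (inv_pos.2 hc)
      split_ifs with h'
      · exact h ω h'
      · exact le_rfl
  have h1 : (1 : ℝ) ≤ ∑ i, ∑ ω, (if Fintype.card ι * t i < f i ω then w ω else 0) := by
    rw [Finset.sum_comm, ← hw.2]
    refine Finset.sum_le_sum fun ω _ => ?_
    obtain ⟨i, hi⟩ := hcon ω
    refine le_trans (by rw [if_pos hi]) (Finset.single_le_sum
      (f := fun i => if Fintype.card ι * t i < f i ω then w ω else 0) (fun j _ => ?_)
      (Finset.mem_univ i))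
    split_ifs
    exacts [hw.1 ω, le_rfl]
  have h2 := Finset.sum_lt_sum_of_nonempty (Finset.univ_nonempty (α := ι)) fun i _ => key i
  simp only [Finset.sum_const, Finset.card_univ, nsmul_eq_mul, mul_inv_cancel₀ hc.ne'] at h2
  linarith

/-! ### Large deviations. -/

/-- Chernoff's bound for the lower tail of a sum of independent variables. -/
theorem exists_sum_iidProb_le_pow {Z : Type*} [Fintype Z] {p : Z → ℝ} (hp : p ∈ stdSimplex ℝ Z)
    (f : Z → ℝ) {a : ℝ} (ha : a < ∑ z, p z * f z) :
    ∃ ρ : ℝ, 0 ≤ ρ ∧ ρ < 1 ∧ ∀ n : ℕ, (open Classical in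
      ∑ z : Fin n → Z, if ∑ i, f (z i) ≤ n * a then iidProb p z else 0) ≤ ρ ^ n := by
  classical
  -- The exponential moment equals 1 at `s = 0` and has negative slope `a - E f` there, so some `s >
  -- 0` makes it less than 1; that value is `ρ`.
  have hd : HasDerivAt (fun s : ℝ => ∑ z, p z * Real.exp (-(s * (f z - a))))
      (∑ z, p z * (Real.exp (-(0 * (f z - a))) * (-(1 * (f z - a))))) 0 :=
    HasDerivAt.fun_sum fun z _ =>
      ((((hasDerivAt_id (0 : ℝ)).mul_const (f z - a)).neg).exp.const_mul (p z))
  have hneg : ∑ z, p z * (Real.exp (-(0 * (f z - a))) * (-(1 * (f z - a)))) < 0 := by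
    have : ∑ z, p z * (Real.exp (-(0 * (f z - a))) * (-(1 * (f z - a))))
        = (∑ z, p z) * a - ∑ z, p z * f z := by
      rw [Finset.sum_mul, ← Finset.sum_sub_distrib]
      refine Finset.sum_congr rfl fun z _ => ?_
      simp
      ring
    rw [this, hp.2]
    linarith
  obtain ⟨s, hs, hs0⟩ := (((hasDerivAt_iff_tendsto_slope.1 hd).mono_left
    (nhdsWithin_mono (0 : ℝ) (s := Set.Ioi 0) (fun x (hx : 0 < x) => hx.ne'))).eventually_lt_const hneg |>.and
      self_mem_nhdsWithin).exists
  have hs0 : 0 < s := hs0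
  simp only [slope_def_field, sub_zero, zero_mul, neg_zero, Real.exp_zero, mul_one, hp.2] at hs
  rw [div_lt_iff₀ hs0, zero_mul, sub_neg] at hs
  refine ⟨_, Finset.sum_nonneg fun z _ => mul_nonneg (hp.1 z) (Real.exp_pos _).le, hs, fun n => ?_⟩
  rw [Fintype.sum_pow]
  refine Finset.sum_le_sum fun z _ => ?_
  rw [Finset.prod_mul_distrib, ← Real.exp_sum]
  split_ifs with h
  · refine le_mul_of_one_le_right (iidProb_nonneg hp.1 z) (Real.one_le_exp ?_)
    rw [Finset.sum_neg_distrib, ← Finset.mul_sum, Finset.sum_sub_distrib]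
    simp only [Finset.sum_const, Finset.card_univ, Fintype.card_fin, nsmul_eq_mul]
    nlinarith
  · exact mul_nonneg (iidProb_nonneg hp.1 z) (Real.exp_pos _).le

/-- A log-likelihood ratio rarely falls below its mean. -/
theorem exists_sum_iidProb_likelihood_le_pow {Z : Type*} [Fintype Z] {p : Z → ℝ}
    (hp : p ∈ stdSimplex ℝ Z) {u v : Z → ℝ} (huv : ∀ z, 0 < p z → 0 < u z ∧ 0 < v z) {a : ℝ}
    (ha : a < ∑ z, p z * Real.logb 2 (u z / v z)) :
    ∃ ρ : ℝ, 0 ≤ ρ ∧ ρ < 1 ∧ ∀ n : ℕ, (open Classical in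
      ∑ z : Fin n → Z, if iidProb u z ≤ 2 ^ (n * a) * iidProb v z then iidProb p z else 0)
        ≤ ρ ^ n := by
  classical
  obtain ⟨ρ, h0, h1, h⟩ := exists_sum_iidProb_le_pow hp _ ha
  refine ⟨ρ, h0, h1, fun n => (Finset.sum_le_sum fun z _ => ?_).trans (h n)⟩
  -- Sequences with a null letter have weight zero; on all others both likelihoods are positive and
  -- logarithms may be taken.
  by_cases hz : ∃ i, p (z i) = 0
  · obtain ⟨i, hi⟩ := hz
    have : iidProb p z = 0 := Finset.prod_eq_zero (Finset.mem_univ i) hi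
    simp [this]
  push Not at hz
  have hz' := fun i => huv _ ((hp.1 (z i)).lt_of_ne' (hz i))
  have hu : 0 < iidProb u z := Finset.prod_pos fun i _ => (hz' i).1
  have hv : 0 < iidProb v z := Finset.prod_pos fun i _ => (hz' i).2
  have : iidProb u z ≤ 2 ^ (n * a) * iidProb v z ↔
      ∑ i, Real.logb 2 (u (z i) / v (z i)) ≤ n * a := by
    rw [← div_le_iff₀ hv, ← Real.logb_le_iff_le_rpow one_lt_two (div_pos hu hv), iidProb, iidProb,
      ← Finset.prod_div_distrib, Real.logb_prod]
    exact fun i _ => (div_pos (hz' i).1 (hz' i).2).ne'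
  simp only [this]
  exact le_rfl

/-! ### Random coding. -/

theorem average_sum_iidProb_mul {M : ℕ} (hM : 0 < M) {A : Type*} [Fintype A] {p : A → ℝ}
    (hp : ∑ a, p a = 1) (g : A → ℝ) :
    ∑ C : Fin M → A, iidProb p C * ((M : ℝ)⁻¹ * ∑ m, g (C m)) = ∑ a, p a * g a := by
  have : ∀ C : Fin M → A, iidProb p C * ((M : ℝ)⁻¹ * ∑ m, g (C m))
      = (M : ℝ)⁻¹ * ∑ m, iidProb p C * g (C m) := fun C => by
    rw [← Finset.mul_sum]; ring
  simp only [this]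
  rw [← Finset.mul_sum, Finset.sum_comm]
  simp only [sum_iidProb_mul hp]
  have : (M : ℝ) ≠ 0 := by exact_mod_cast hM.ne'
  simp [this]

/-- One-shot random coding for a family of channels with a common threshold decoder and a test. -/
theorem exists_codebook {A B : Type*} [Fintype A] [Fintype B] {p : A → ℝ}
    (hp : p ∈ stdSimplex ℝ A) {W : Fin 2 → A → B → ℝ} (hW : ∀ θ a, W θ a ∈ stdSimplex ℝ B)
    (pass : A → B → Prop) (wrong : Fin 2 → B → Prop) [∀ a b, Decidable (pass a b)]
    [∀ θ b, Decidable (wrong θ b)] {e α : Fin 2 → ℝ} {K : ℝ}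
    (he : ∀ θ, ∑ a, p a * ∑ b, (if pass a b then 0 else W θ a b) ≤ e θ)
    (hK : ∀ b, ∑ a, p a * (if pass a b then 1 else 0) ≤ K)
    (hα : ∀ θ, ∑ a, p a * ∑ b, (if wrong θ b then W θ a b else 0) ≤ α θ)
    {M : ℕ} (hM : 0 < M) :
    ∃ (C : Fin M → A) (d : B → Fin M),
      (∀ θ, (M : ℝ)⁻¹ * ∑ m, ∑ b with d b ≠ m, W θ (C m) b ≤ 4 * (e θ + (M - 1) * K)) ∧
      (∀ θ, (M : ℝ)⁻¹ * ∑ m, ∑ b, (if wrong θ b then W θ (C m) b else 0) ≤ 4 * α θ) := by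
  classical
  let g : Fin 2 → A → ℝ := fun θ a => ∑ b, (if pass a b then 0 else W θ a b)
  -- Expected number of wrong codewords that pass. Only pairwise independence of the codewords is
  -- needed to bound its mean.
  let c : Fin 2 → (Fin M → A) → Fin M → ℝ := fun θ C m =>
    ∑ m' ∈ Finset.univ.erase m, ∑ b, W θ (C m) b * (if pass (C m') b then 1 else 0)
  have hg : ∀ θ a, 0 ≤ g θ a := fun θ a => Finset.sum_nonneg fun b _ => by
    split_ifs; exacts [le_rfl, (hW θ a).1 b]
  have hc : ∀ θ C m, 0 ≤ c θ C m := fun θ C m => Finset.sum_nonneg fun m' _ =>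
    Finset.sum_nonneg fun b _ => mul_nonneg ((hW _ _).1 b) (by split_ifs <;> norm_num)
  have hMi : (0 : ℝ) ≤ (M : ℝ)⁻¹ := by positivity
  have hM' : (M : ℝ) ≠ 0 := by exact_mod_cast hM.ne'
  have hEc : ∀ θ m, ∑ C : Fin M → A, iidProb p C * c θ C m ≤ (M - 1) * K := by
    intro θ m
    have h1 : ∑ C : Fin M → A, iidProb p C * c θ C m = ∑ m' ∈ Finset.univ.erase m, ∑ b,
        (∑ a, p a * W θ a b) * ∑ a, p a * (if pass a b then 1 else 0) := by
      simp only [c, Finset.mul_sum]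
      rw [Finset.sum_comm]
      refine Finset.sum_congr rfl fun m' hm' => ?_
      rw [Finset.sum_comm]
      refine Finset.sum_congr rfl fun b _ => ?_
      rw [← Finset.mul_sum]
      exact sum_iidProb_mul_mul hp.2 (Finset.ne_of_mem_erase hm').symm (fun a => W θ a b)
        fun a => if pass a b then 1 else 0
    have h2 : ∑ b, (∑ a, p a * W θ a b) * (∑ a, p a * (if pass a b then 1 else 0)) ≤ K := by
      refine (Finset.sum_le_sum fun b _ => mul_le_mul_of_nonneg_left (hK b)
        (Finset.sum_nonneg fun a _ => mul_nonneg (hp.1 a) ((hW θ a).1 b))).trans ?_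
      rw [← Finset.sum_mul, Finset.sum_comm]
      simp [← Finset.mul_sum, (hW θ _).2, hp.2]
    rw [h1, Finset.sum_const, Finset.card_erase_of_mem (Finset.mem_univ _), Finset.card_univ,
      Fintype.card_fin, nsmul_eq_mul, Nat.cast_pred hM]
    exact mul_le_mul_of_nonneg_left h2 (sub_nonneg.2 (by exact_mod_cast hM))
  obtain ⟨C, hC⟩ := exists_forall_le_card_mul (ι := Fin 2 ⊕ Fin 2)
    (iidProb_mem_stdSimplex (ι := Fin M) hp)
    (f := Sum.elim (fun θ C => (M : ℝ)⁻¹ * ∑ m, (g θ (C m) + c θ C m))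
      (fun θ C => (M : ℝ)⁻¹ * ∑ m, ∑ b, (if wrong θ b then W θ (C m) b else 0)))
    (t := Sum.elim (fun θ => e θ + (M - 1) * K) α)
    (by
      rintro (θ | θ) C
      · exact mul_nonneg hMi (Finset.sum_nonneg fun m _ => add_nonneg (hg _ _) (hc _ _ _))
      · refine mul_nonneg hMi (Finset.sum_nonneg fun m _ => Finset.sum_nonneg fun b _ => ?_)
        split_ifs
        exacts [(hW _ _).1 b, le_rfl])
    (by
      rintro (θ | θ)
      · simp only [Sum.elim_inl, Finset.sum_add_distrib, mul_add]
        refine add_le_add ((average_sum_iidProb_mul hM hp.2 (g θ)).trans_le (he θ)) ?_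
        have : ∀ C : Fin M → A, iidProb p C * ((M : ℝ)⁻¹ * ∑ m, c θ C m)
            = (M : ℝ)⁻¹ * ∑ m, iidProb p C * c θ C m := fun C => by
          rw [← Finset.mul_sum]; ring
        simp only [this]
        rw [← Finset.mul_sum, Finset.sum_comm]
        refine (mul_le_mul_of_nonneg_left (Finset.sum_le_sum fun m _ => hEc θ m) hMi).trans_eq ?_
        simp [hM']
      · exact (average_sum_iidProb_mul hM hp.2 _).trans_le (hα θ))
  have h4 : (Fintype.card (Fin 2 ⊕ Fin 2) : ℝ) = 4 := by norm_num [Fintype.card_sum]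
  rw [h4] at hC
  -- Any passing message will do: if the choice is wrong, either the true codeword failed or the
  -- chosen wrong one passed.
  let d : B → Fin M := fun b => if h : ∃ m, pass (C m) b then h.choose else ⟨0, hM⟩
  refine ⟨C, d, fun θ => le_trans ?_ (hC (.inl θ)), fun θ => hC (.inr θ)⟩
  refine mul_le_mul_of_nonneg_left (Finset.sum_le_sum fun m _ => ?_) hMi
  simp only [g, c]
  rw [Finset.sum_filter, Finset.sum_comm, ← Finset.sum_add_distrib]
  refine Finset.sum_le_sum fun b _ => ?_
  have hn : ∀ m' ∈ Finset.univ.erase m, 0 ≤ W θ (C m) b * (if pass (C m') b then (1 : ℝ) else 0) :=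
    fun m' _ => mul_nonneg ((hW _ _).1 b) (by split_ifs <;> norm_num)
  by_cases hdb : d b = m
  · rw [if_neg (not_not.2 hdb)]
    refine add_nonneg ?_ (Finset.sum_nonneg hn)
    split_ifs
    exacts [le_rfl, (hW _ _).1 b]
  · rw [if_pos hdb]
    by_cases hpm : pass (C m) b
    · have hex : ∃ m, pass (C m) b := ⟨m, hpm⟩
      have hd : pass (C (d b)) b := by
        simp only [d, dif_pos hex]
        exact hex.choose_spec
      rw [if_pos hpm, zero_add]
      refine le_trans ?_ (Finset.single_le_sum hn (Finset.mem_erase.2 ⟨hdb, Finset.mem_univ _⟩))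
      rw [if_pos hd, mul_one]
    · rw [if_neg hpm]
      exact le_add_of_nonneg_right (Finset.sum_nonneg hn)

/-! ### Hypothesis testing. -/

/-- The achievability part of Stein's lemma. -/
theorem exists_test {Y : Type*} [Fintype Y] {q₀ q₁ : Y → ℝ} (h₀ : q₀ ∈ stdSimplex ℝ Y)
    (h₁ : q₁ ∈ stdSimplex ℝ Y) {δ : ℝ} (hδ : 0 < δ) (c : ℝ) : (open Classical in
    ∃ ρ : ℝ, 0 ≤ ρ ∧ ρ < 1 ∧ ∀ᶠ n : ℕ in atTop, ∃ T : (Fin n → Y) → Prop,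
      (∑ y : Fin n → Y, if T y then 0 else iidProb q₀ y) ≤ ρ ^ n ∧
      c * (∑ y : Fin n → Y, if T y then iidProb q₁ y else 0)
        ≤ twoPowNeg ((n : EReal) * (klBits q₀ q₁ - (δ : EReal)))) := by
  classical
  by_cases hac : ∀ y, q₁ y = 0 → q₀ y = 0
  · obtain ⟨ρ, hρ0, hρ1, hρ⟩ := exists_sum_iidProb_likelihood_le_pow h₀ (u := q₀) (v := q₁)
      (fun z hz => ⟨hz, (h₁.1 z).lt_of_ne' fun h => hz.ne' (hac z h)⟩)
      -- Half of `δ` is spent on the threshold; the other half absorbs the factor `c` for large `n`.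
      (sub_lt_self (∑ y, q₀ y * Real.logb 2 (q₀ y / q₁ y)) (half_pos hδ))
    refine ⟨ρ, hρ0, hρ1, ?_⟩
    set D := ∑ y, q₀ y * Real.logb 2 (q₀ y / q₁ y) with hD
    have hlim : Tendsto (fun n : ℕ => ((2 : ℝ) ^ (δ / 2)) ^ n) atTop atTop :=
      tendsto_pow_atTop_atTop_of_one_lt (Real.one_lt_rpow one_lt_two (half_pos hδ))
    filter_upwards [hlim.eventually_ge_atTop c] with n hn
    refine ⟨fun y => ¬ iidProb q₀ y ≤ 2 ^ (n * (D - δ / 2)) * iidProb q₁ y, ?_, ?_⟩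
    · refine le_of_eq_of_le (Finset.sum_congr rfl fun y _ => ?_) (hρ n)
      by_cases h : iidProb q₀ y ≤ 2 ^ (n * (D - δ / 2)) * iidProb q₁ y <;> simp [h]
    · have hkl : klBits q₀ q₁ = ((D : ℝ) : EReal) := if_pos hac
      have hE : (n : EReal) * (klBits q₀ q₁ - (δ : EReal)) = ((n * (D - δ) : ℝ) : EReal) := by
        rw [hkl]
        norm_cast
      rw [hE, twoPowNeg, if_neg (EReal.coe_ne_top _), EReal.toReal_coe]
      have hS : (∑ y : Fin n → Y, if ¬ iidProb q₀ y ≤ 2 ^ (n * (D - δ / 2)) * iidProb q₁ y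
          then iidProb q₁ y else 0) ≤ 2 ^ (-(n * (D - δ / 2))) := by
        have hs := (iidProb_mem_stdSimplex (ι := Fin n) h₀).2
        calc _ ≤ ∑ y : Fin n → Y, 2 ^ (-(n * (D - δ / 2))) * iidProb q₀ y := by
              refine Finset.sum_le_sum fun y _ => ?_
              split_ifs with h
              · exact mul_nonneg (by positivity) (iidProb_nonneg h₀.1 y)
              · rw [Real.rpow_neg zero_le_two, ← div_eq_inv_mul, le_div_iff₀' (by positivity)]
                exact (not_le.1 h).le
          _ = _ := by rw [← Finset.mul_sum, hs, mul_one]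
      have hnn : 0 ≤ (∑ y : Fin n → Y, if ¬ iidProb q₀ y ≤ 2 ^ (n * (D - δ / 2)) * iidProb q₁ y
          then iidProb q₁ y else 0) := Finset.sum_nonneg fun y _ => by
        split_ifs; exacts [le_rfl, iidProb_nonneg h₁.1 y]
      refine le_trans (le_of_eq (by congr!)) ((mul_le_mul hn hS hnn (by positivity)).trans_eq ?_)
      rw [← Real.rpow_natCast, ← Real.rpow_mul zero_le_two, ← Real.rpow_add two_pos]
      congr 1
      ring
  · have hac' := hac
    push Not at hac'
    obtain ⟨y₀, hy1, hy0⟩ := hac'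
    -- The test accepts sequences impossible under `q₁`. It misses only if every letter lies in the
    -- support of `q₁`, whose `q₀`-mass `ρ` is below 1.
    refine ⟨∑ y, if q₁ y = 0 then 0 else q₀ y, Finset.sum_nonneg fun y _ => ?_, ?_, ?_⟩
    · split_ifs; exacts [le_rfl, h₀.1 y]
    · rw [← h₀.2]
      refine Finset.sum_lt_sum (fun y _ => ?_) ⟨y₀, Finset.mem_univ _, ?_⟩
      · split_ifs; exacts [h₀.1 y, le_rfl]
      · rw [if_pos hy1]; exact (h₀.1 y₀).lt_of_ne' hy0
    · filter_upwards [eventually_gt_atTop 0] with n hn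
      refine ⟨fun y => iidProb q₁ y = 0, ?_, ?_⟩
      · rw [Fintype.sum_pow]
        refine Finset.sum_le_sum fun y _ => ?_
        split_ifs with h
        · exact Finset.prod_nonneg fun i _ => by split_ifs; exacts [le_rfl, h₀.1 _]
        · refine Finset.prod_le_prod (fun i _ => h₀.1 _) fun i _ => ?_
          rw [if_neg fun hi => h (Finset.prod_eq_zero (Finset.mem_univ i) hi)]
      · have hE : (n : EReal) * (klBits q₀ q₁ - (δ : EReal)) = ⊤ := by
          rw [klBits, if_neg hac, EReal.top_sub_coe]
          exact EReal.mul_top_of_pos (by exact_mod_cast hn)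
        rw [hE, twoPowNeg, if_pos rfl]
        refine le_of_eq ?_
        rw [Finset.sum_eq_zero, mul_zero]
        intro y _
        split_ifs with h
        exacts [h, rfl]

/-! ### Information density of a memoryless channel. -/

/-- The transition probabilities of `V` used without memory along a sequence of inputs. -/
def memoryless {ι X Y : Type*} [Fintype ι] (V : X → Y → ℝ) (x : ι → X) (y : ι → Y) : ℝ :=
  ∏ i, V (x i) (y i)

theorem memoryless_mem_stdSimplex {ι X Y : Type*} [Fintype ι] [DecidableEq ι] [Fintype Y]
    {V : X → Y → ℝ} (hV : ∀ x, V x ∈ stdSimplex ℝ Y) (x : ι → X) :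
    memoryless V x ∈ stdSimplex ℝ (ι → Y) := by
  refine ⟨fun y => Finset.prod_nonneg fun i _ => (hV _).1 _, ?_⟩
  have := Finset.prod_univ_sum (fun _ : ι => (Finset.univ : Finset Y)) fun i y => V (x i) y
  simp only [(hV _).2, Finset.prod_const_one, Fintype.piFinset_univ] at this
  exact this.symm

theorem sum_iidProb_mul_memoryless {ι X Y : Type*} [Fintype ι] [DecidableEq ι] [Fintype X]
    (P : X → ℝ) (V : X → Y → ℝ) (y : ι → Y) :
    ∑ x : ι → X, iidProb P x * memoryless V x y = iidProb (fun b => ∑ a, P a * V a b) y := by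
  have := sum_iidProb_mul_prod (ι := ι) P fun i a => V a (y i)
  rw [iidProb, ← this]
  congr!

/-- The probability that an independent input sequence has large information density with a given
output sequence. -/
theorem sum_iidProb_density_le {ι X Y : Type*} [Fintype ι] [DecidableEq ι] [Fintype X] [Fintype Y]
    {P : X → ℝ} (hP : P ∈ stdSimplex ℝ X) {V : X → Y → ℝ} (hV : ∀ x, V x ∈ stdSimplex ℝ Y)
    (t : ℝ) (y : ι → Y) : (open Classical in
      ∑ x : ι → X, iidProb P x *
        (if 2 ^ t * iidProb (fun b => ∑ a, P a * V a b) y < memoryless V x y then 1 else 0))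
      ≤ (2 : ℝ) ^ (-t) := by
  classical
  have hq : ∀ b, 0 ≤ ∑ a, P a * V a b := fun b =>
    Finset.sum_nonneg fun a _ => mul_nonneg (hP.1 a) ((hV a).1 b)
  have hPV : ∀ x : ι → X, 0 ≤ iidProb P x * memoryless V x y := fun x =>
    mul_nonneg (iidProb_nonneg hP.1 x) ((memoryless_mem_stdSimplex hV x).1 y)
  set q := iidProb (fun b => ∑ a, P a * V a b) y with hqdef
  have hsum : ∑ x : ι → X, iidProb P x * memoryless V x y = q := sum_iidProb_mul_memoryless P V y
  have hq0 : 0 ≤ q := iidProb_nonneg hq y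
  -- If `y` has output probability zero, a passing `x` has positive likelihood and hence probability
  -- zero. Otherwise this is a change of measure to the posterior of `x`.
  rcases hq0.eq_or_lt with h0 | h0
  · rw [← h0] at hsum
    rw [Finset.sum_eq_zero]
    · positivity
    intro x hx
    split_ifs with h
    · rw [← h0, mul_zero] at h
      rw [mul_one]
      exact (mul_eq_zero.1 ((Finset.sum_eq_zero_iff_of_nonneg fun x _ => hPV x).1 hsum x hx)
        ).resolve_right h.ne'
    · exact mul_zero _
  · rw [Real.rpow_neg zero_le_two, ← one_div, le_div_iff₀ (by positivity)]
    refine le_of_mul_le_mul_right ?_ h0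
    rw [mul_assoc, one_mul, Finset.sum_mul]
    refine le_trans (Finset.sum_le_sum fun x _ => ?_) hsum.le
    split_ifs with h
    · rw [mul_one]
      exact mul_le_mul_of_nonneg_left h.le (iidProb_nonneg hP.1 x)
    · simpa using hPV x

/-- The information density rarely falls below the mutual information. -/
theorem exists_sum_memoryless_density_le_pow {X Y : Type*} [Fintype X] [Fintype Y]
    {P : X → ℝ} (hP : P ∈ stdSimplex ℝ X) {V : X → Y → ℝ} (hV : ∀ x, V x ∈ stdSimplex ℝ Y)
    {γ : ℝ} (hγ : γ < mutualInfoBits fun x y => P x * V x y) :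
    ∃ ρ : ℝ, 0 ≤ ρ ∧ ρ < 1 ∧ ∀ n : ℕ, (open Classical in
      ∑ x : Fin n → X, iidProb P x * ∑ y : Fin n → Y,
        (if 2 ^ (n * γ) * iidProb (fun b => ∑ a, P a * V a b) y < memoryless V x y then 0
          else memoryless V x y)) ≤ ρ ^ n := by
  classical
  let J : X × Y → ℝ := fun z => P z.1 * V z.1 z.2
  let q : Y → ℝ := fun b => ∑ a, P a * V a b
  have hJ0 : ∀ z, 0 ≤ J z := fun z => mul_nonneg (hP.1 _) ((hV _).1 _)
  have hJ : J ∈ stdSimplex ℝ (X × Y) := by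
    refine ⟨hJ0, ?_⟩
    rw [Fintype.sum_prod_type]
    simp [J, ← Finset.mul_sum, (hV _).2, hP.2]
  have hpos : ∀ z, 0 < J z → 0 < P z.1 ∧ 0 < V z.1 z.2 ∧ 0 < q z.2 := by
    intro z hz
    have h1 : P z.1 ≠ 0 := left_ne_zero_of_mul hz.ne'
    have h2 : V z.1 z.2 ≠ 0 := right_ne_zero_of_mul hz.ne'
    exact ⟨(hP.1 _).lt_of_ne' h1, ((hV _).1 _).lt_of_ne' h2, hz.trans_le
      (Finset.single_le_sum (f := fun a => P a * V a z.2) (fun a _ => hJ0 (a, z.2))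
        (Finset.mem_univ z.1))⟩
  have hmean : γ < ∑ z, J z * Real.logb 2 (V z.1 z.2 / q z.2) := by
    refine hγ.trans_eq ?_
    rw [mutualInfoBits, Fintype.sum_prod_type]
    refine Finset.sum_congr rfl fun x _ => Finset.sum_congr rfl fun y _ => ?_
    rcases (hJ0 (x, y)).eq_or_lt with h | h
    · simp only [J] at h ⊢
      rw [← h, zero_mul, zero_mul]
    · simp only [J, q, ← Finset.mul_sum, (hV _).2, mul_one]
      rw [mul_div_mul_left _ _ (hpos _ h).1.ne']
  obtain ⟨ρ, h0, h1, h⟩ := exists_sum_iidProb_likelihood_le_pow hJ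
    (u := fun z => V z.1 z.2) (v := fun z => q z.2) (fun z hz => (hpos z hz).2) hmean
  refine ⟨ρ, h0, h1, fun n => le_of_eq_of_le ?_ (h n)⟩
  rw [← (Equiv.arrowProdEquivProdArrow (Fin n) (fun _ => X) (fun _ => Y)).symm.sum_comp,
    Fintype.sum_prod_type]
  refine Finset.sum_congr rfl fun x _ => ?_
  rw [Finset.mul_sum]
  refine Finset.sum_congr rfl fun y _ => ?_
  have e1 : iidProb J ((Equiv.arrowProdEquivProdArrow (Fin n) (fun _ => X) (fun _ => Y)).symm (x, y))
      = iidProb P x * memoryless V x y := Finset.prod_mul_distrib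
  have e2 : iidProb (fun z : X × Y => V z.1 z.2)
      ((Equiv.arrowProdEquivProdArrow (Fin n) (fun _ => X) (fun _ => Y)).symm (x, y))
      = memoryless V x y := rfl
  have e3 : iidProb (fun z : X × Y => q z.2)
      ((Equiv.arrowProdEquivProdArrow (Fin n) (fun _ => X) (fun _ => Y)).symm (x, y))
      = iidProb q y := rfl
  rw [e1, e2, e3]
  by_cases hc : 2 ^ (n * γ) * iidProb q y < memoryless V x y
  · rw [if_neg hc.not_ge, if_pos hc, mul_zero]
  · rw [if_pos (not_lt.1 hc), if_neg hc]

/-! ### Choice of the rate and assembly. -/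

/-- The floor loses at most a factor 2, covered by `n * (δ / 2) ≥ 1`. The maximum with 1 handles `R
< δ / 2`; then `M = 1`, which is why the last bound concerns `M - 1`. -/
theorem exists_message_count {R δ : ℝ} (hR : 0 ≤ R) (hδ : 0 < δ) :
    ∀ᶠ n : ℕ in atTop, ∃ M : ℕ, 0 < M ∧ R - δ ≤ Real.logb 2 M / n ∧ Real.logb 2 M / n ≤ R ∧
      (M : ℝ) - 1 ≤ 2 ^ (n * (R - δ / 2)) := by
  have hlim : Tendsto (fun n : ℕ => (n : ℝ) * (δ / 2)) atTop atTop :=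
    tendsto_natCast_atTop_atTop.atTop_mul_const (half_pos hδ)
  filter_upwards [hlim.eventually_ge_atTop 1, eventually_gt_atTop 0] with n hn hn0
  have hn0' : (0 : ℝ) < n := by exact_mod_cast hn0
  set z : ℝ := 2 ^ (n * (R - δ / 2)) with hz
  have hz0 : 0 < z := by positivity
  have hM1 : 1 ≤ ⌊max 1 z⌋₊ := Nat.le_floor (by simp)
  have hM1' : (1 : ℝ) ≤ (⌊max 1 z⌋₊ : ℝ) := by exact_mod_cast hM1
  have hMle : (⌊max 1 z⌋₊ : ℝ) ≤ max 1 z := Nat.floor_le (by positivity)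
  have hMge : max 1 z / 2 ≤ (⌊max 1 z⌋₊ : ℝ) := by
    have := Nat.lt_floor_add_one (max 1 z)
    linarith
  refine ⟨⌊max 1 z⌋₊, hM1, ?_, ?_, ?_⟩
  · rw [le_div_iff₀ hn0', Real.le_logb_iff_rpow_le one_lt_two (by linarith)]
    refine le_trans ?_ (le_trans (div_le_div_of_nonneg_right (le_max_right 1 z) zero_le_two) hMge)
    rw [hz, le_div_iff₀ two_pos]
    nth_rewrite 2 [← Real.rpow_one 2]
    rw [← Real.rpow_add two_pos]
    refine Real.rpow_le_rpow_of_exponent_le one_le_two ?_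
    linarith
  · rw [div_le_iff₀ hn0', Real.logb_le_iff_le_rpow one_lt_two (by linarith)]
    refine hMle.trans (max_le (Real.one_le_rpow one_le_two (by positivity)) ?_)
    refine Real.rpow_le_rpow_of_exponent_le one_le_two ?_
    nlinarith
  · rcases max_cases 1 z with h | h <;> rw [h.1] at hMle ⊢ <;> linarith

theorem averagedChannel_mem_stdSimplex {X₁ X₂ Y : Type*} [Fintype X₂] [Fintype Y]
    {Q : X₁ → X₂ → Y → ℝ} (hQ : ∀ x₁ x₂, Q x₁ x₂ ∈ stdSimplex ℝ Y) {P : X₂ → ℝ}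
    (hP : P ∈ stdSimplex ℝ X₂) (x₁ : X₁) : averagedChannel Q P x₁ ∈ stdSimplex ℝ Y := by
  refine ⟨fun y => Finset.sum_nonneg fun a _ => mul_nonneg (hP.1 a) ((hQ _ a).1 y), ?_⟩
  simp only [averagedChannel]
  rw [Finset.sum_comm]
  simp [← Finset.mul_sum, (hQ _ _).2, hP.2]

theorem lemma9 {X₁ X₂ Y : Type*} [Fintype X₁] [Fintype X₂] [Fintype Y]
    -- a discrete memoryless multiple-access channel
    (Q : X₁ → X₂ → Y → ℝ) (hQ : ∀ x₁ x₂, Q x₁ x₂ ∈ stdSimplex ℝ Y)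
    -- the repeated symbols `x₁(0)`, `x₁(1)` and the input distribution of the second user
    (x₁ : Fin 2 → X₁) (P : X₂ → ℝ) (hP : P ∈ stdSimplex ℝ X₂)
    -- the target rate
    (R : ℝ) (hR₀ : 0 ≤ R) (hR : R ≤ min (condInfo Q P (x₁ 0)) (condInfo Q P (x₁ 1)))
    (ε δ : ℝ) (hε : 0 < ε) (hδ : 0 < δ) :
    ∀ᶠ n : ℕ in atTop, ∃ (M : ℕ) (c : HybridCode X₁ X₂ Y n M),
      -- the first user repeats the symbol `x₁(θ)`
      (∀ θ i, c.enc₁ θ i = x₁ θ) ∧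
      -- the rate of the second user
      0 < M ∧ R - δ ≤ Real.logb 2 M / n ∧ Real.logb 2 M / n ≤ R ∧
      -- the message is decoded reliably under both values of the bit
      (∀ θ, c.msgError Q θ ≤ ε) ∧
      -- the error of the first kind vanishes
      c.bitProb Q 1 0 ≤ ε ∧
      -- the error of the second kind has the stated exponent
      c.bitProb Q 0 1 ≤ twoPowNeg
        ((n : EReal) * (klBits (averagedChannel Q P (x₁ 0)) (averagedChannel Q P (x₁ 1))
          - (δ : EReal))) := by
  classical
  -- The threshold lies strictly between the coding rate `R - δ / 2` and both informations, even
  -- when `R` equals one of them.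
  have hI : ∀ θ, R - δ / 4 < condInfo Q P (x₁ θ) := by
    intro θ
    have h : R ≤ condInfo Q P (x₁ θ) := by
      fin_cases θ
      exacts [hR.trans (min_le_left _ _), hR.trans (min_le_right _ _)]
    linarith
  choose ρ hρ0 hρ1 hρ using fun θ =>
    exists_sum_memoryless_density_le_pow hP (V := Q (x₁ θ)) (hQ _) (hI θ)
  obtain ⟨σ, hσ0, hσ1, hσ⟩ := exists_test (averagedChannel_mem_stdSimplex hQ hP (x₁ 0))
    (averagedChannel_mem_stdSimplex hQ hP (x₁ 1)) hδ 4
  have hlim : ∀ θ, Tendsto (fun n : ℕ => 4 * (ρ θ ^ n + 2 * ((2 : ℝ) ^ (-(δ / 4))) ^ n)) atTop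
      (nhds 0) := by
    intro θ
    have h1 := tendsto_pow_atTop_nhds_zero_of_lt_one (hρ0 θ) (hρ1 θ)
    have h2 := tendsto_pow_atTop_nhds_zero_of_lt_one (r := (2 : ℝ) ^ (-(δ / 4))) (by positivity)
      (Real.rpow_lt_one_of_one_lt_of_neg one_lt_two (by linarith))
    simpa using (h1.add (h2.const_mul 2)).const_mul 4
  have hlim' : Tendsto (fun n : ℕ => 4 * σ ^ n) atTop (nhds 0) := by
    simpa using (tendsto_pow_atTop_nhds_zero_of_lt_one hσ0 hσ1).const_mul 4
  filter_upwards [hσ, exists_message_count hR₀ hδ,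
    eventually_all.2 fun θ => (hlim θ).eventually_le_const hε, hlim'.eventually_le_const hε]
    with n ⟨T, hT0, hT1⟩ ⟨M, hM, hMl, hMu, hMz⟩ hε1 hε2
  -- The message decoder does not know the bit, so it accepts under either hypothesis; this costs
  -- the factor 2 in `K`.
  let pass : (Fin n → X₂) → (Fin n → Y) → Prop := fun x y => ∃ θ,
    2 ^ (n * (R - δ / 4)) * iidProb (averagedChannel Q P (x₁ θ)) y < memoryless (Q (x₁ θ)) x y
  let wrong : Fin 2 → (Fin n → Y) → Prop := fun θ y => if θ = 0 then ¬ T y else T y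
  have hWn : ∀ θ (x : Fin n → X₂), memoryless (Q (x₁ θ)) x ∈ stdSimplex ℝ (Fin n → Y) :=
    fun θ => memoryless_mem_stdSimplex (hQ _)
  have hPn := iidProb_mem_stdSimplex (ι := Fin n) hP
  obtain ⟨C, d, hd, ht⟩ := exists_codebook hPn hWn pass wrong
    (e := fun θ => ρ θ ^ n) (K := 2 * 2 ^ (-(n * (R - δ / 4))))
    -- These are the errors of the Stein test under the averaged output laws; the constant 4 given
    -- to `exists_test` pays for Markov's inequality.
    (α := fun θ => ∑ y, if wrong θ y then iidProb (averagedChannel Q P (x₁ θ)) y else 0)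
    (by
      intro θ
      refine (Finset.sum_le_sum fun x _ => mul_le_mul_of_nonneg_left
        (Finset.sum_le_sum fun y _ => ?_) (hPn.1 x)).trans (hρ θ n)
      split_ifs with h1 h2 h2
      · exact le_rfl
      · exact (hWn θ x).1 y
      · exact (h1 ⟨θ, h2⟩).elim
      · exact le_rfl)
    (by
      intro y
      have h := fun θ => sum_iidProb_density_le hP (V := Q (x₁ θ)) (hQ _) (n * (R - δ / 4)) y
      rw [two_mul]
      refine le_trans ?_ (add_le_add (h 0) (h 1))
      rw [← Finset.sum_add_distrib]
      refine Finset.sum_le_sum fun x _ => ?_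
      rw [← mul_add]
      refine mul_le_mul_of_nonneg_left ?_ (hPn.1 x)
      have hn : ∀ p : Prop, (0 : ℝ) ≤ if p then 1 else 0 := fun p => by split_ifs <;> norm_num
      by_cases hp : pass x y
      · rw [if_pos hp]
        obtain ⟨θ, hθ⟩ := hp
        fin_cases θ
        · exact le_add_of_le_of_nonneg (if_pos hθ).ge (hn _)
        · exact le_add_of_nonneg_of_le (hn _) (if_pos hθ).ge
      · rw [if_neg hp]
        exact add_nonneg (hn _) (hn _))
    (by
      intro θ
      simp only [Finset.mul_sum]
      rw [Finset.sum_comm]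
      refine Finset.sum_le_sum fun y _ => ?_
      split_ifs
      · exact (sum_iidProb_mul_memoryless P (Q (x₁ θ)) y).le
      · simp) hM
  refine ⟨M, ⟨fun θ _ => x₁ θ, C, fun y => if T y then 0 else 1, d⟩, fun _ _ => rfl, hM, hMl, hMu,
    fun θ => ?_, ?_, ?_⟩
  · refine (hd θ).trans (le_trans ?_ (hε1 θ))
    have : ((M : ℝ) - 1) * (2 * 2 ^ (-(n * (R - δ / 4)))) ≤ 2 * ((2 : ℝ) ^ (-(δ / 4))) ^ n := by
      refine (mul_le_mul_of_nonneg_right hMz (by positivity)).trans_eq ?_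
      rw [mul_left_comm, ← Real.rpow_add two_pos, ← Real.rpow_natCast, ← Real.rpow_mul zero_le_two]
      congr 2
      ring
    linarith
  · refine le_of_eq_of_le ?_ ((ht 0).trans ((mul_le_mul_of_nonneg_left ?_ zero_le_four).trans hε2))
    · simp only [HybridCode.bitProb, Finset.sum_filter]
      congr! 5 with m _ y _
      simp [wrong]
    · refine le_of_eq_of_le (Finset.sum_congr rfl fun y _ => ?_) hT0
      by_cases h : T y <;> simp [wrong, h]
  · refine le_of_eq_of_le ?_ ((ht 1).trans (le_of_eq_of_le ?_ hT1))
    · simp only [HybridCode.bitProb, Finset.sum_filter]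
      congr! 5 with m _ y _
      simp [wrong]
    · congr! 3 with y _
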